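/- Let $m\ge 1$ be an odd integer, and put $\varphi_k=\cos\frac{(2k+1)\pi}{m}$. Then $$\int_0^1\frac{\log(x^m+1)}{x^2+1}\,dx=\frac{\pi m}{8}\log 2-\frac12\sum_{k=0}^{\frac{m-3}{2}}\ \sum_{n=0}^{\infty}\frac{2^n\sum_{p=1}^{n}\frac{(\varphi_k+1)^p}{p}}{(2n+1)\binom{2n}{n}},$$ where each of the infinite series over $n$ converges absolutely, and an empty sum (the sum over $p$ for $n=0$, and the sum over $k$ for $m=1$) is zero. -/

import Mathlib

open scoped BigOperators

/-- The number `φ_k = cos ((2k+1)π/m)`. -/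
noncomputable def phi (m k : ℕ) : ℝ :=
  Real.cos ((2 * (k : ℝ) + 1) * Real.pi / (m : ℝ))

/-- The `n`-th term `2^n (∑_{p=1}^n (φ_k+1)^p / p) / ((2n+1) C(2n,n))` of the inner series. -/
noncomputable def innerTerm (m k n : ℕ) : ℝ :=
  (2 : ℝ) ^ n * (∑ p ∈ Finset.Icc 1 n, (phi m k + 1) ^ p / (p : ℝ)) /
    ((2 * (n : ℝ) + 1) * ((2 * n).choose n : ℝ))

/-! For `m = 2r+1`, `x^m + 1` is `x + 1` times the `r` quadratics `x² - 2φ_k x + 1`, so the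
logarithm splits. The linear factor contributes `(π/8) log 2`. For a quadratic, put `y = φ_k + 1`:
the substitution `t = x/(1+x)` relates its integral to that of `-log(1 - yq)/(1 - q)` with `q =
2t(1-t)`, leaving `(π/4) log 2` (`integral_log_quadratic_div`). Expanding in powers of `q` and
integrating termwise with the Beta integral of `(t(1-t))^n` gives the inner series
(`hasSum_central_binom_sum`). The constants add up to `π/8 + rπ/4 = πm/8`. -/

/-! ### Beta integrals and the series expansion. -/

theorem integral_mul_one_sub_pow (n : ℕ) :
    ∫ t in (0 : ℝ)..1, (t * (1 - t)) ^ n = 1 / ((2 * (n : ℝ) + 1) * (n.centralBinom : ℝ)) := by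
  induction n with
  | zero => simp
  | succ n ih =>
    -- This primitive vanishes at 0 and 1, whence `(4n+6) I_{n+1} = (n+1) I_n`.
    have hderiv : ∀ t : ℝ, HasDerivAt (fun t : ℝ => (t * (1 - t)) ^ (n + 1) * (2 * t - 1))
        ((4 * (n : ℝ) + 6) * (t * (1 - t)) ^ (n + 1) - ((n : ℝ) + 1) * (t * (1 - t)) ^ n) t := by
      intro t
      have h1 : HasDerivAt (fun t : ℝ => t * (1 - t)) (1 * (1 - t) + t * (-1)) t :=
        (hasDerivAt_id t).mul ((hasDerivAt_id t).const_sub 1)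
      have h2 : HasDerivAt (fun t : ℝ => 2 * t - 1) (2 * 1) t :=
        ((hasDerivAt_id t).const_mul 2).sub_const 1
      refine ((h1.pow (n + 1)).mul h2).congr_deriv ?_
      push_cast
      simp only [Pi.pow_apply]
      ring
    have hint : ∀ k : ℕ, IntervalIntegrable (fun t : ℝ => (t * (1 - t)) ^ k)
        MeasureTheory.volume 0 1 := fun k => (by fun_prop : Continuous _).intervalIntegrable _ _
    have key := intervalIntegral.integral_eq_sub_of_hasDerivAt (a := 0) (b := 1)
      (fun t _ => hderiv t) (((hint (n + 1)).const_mul _).sub ((hint n).const_mul _))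
    rw [intervalIntegral.integral_sub ((hint (n + 1)).const_mul _) ((hint n).const_mul _),
      intervalIntegral.integral_const_mul, intervalIntegral.integral_const_mul, ih] at key
    have hc : ((n : ℝ) + 1) * ((n + 1).centralBinom : ℝ) =
        2 * (2 * (n : ℝ) + 1) * (n.centralBinom : ℝ) := by
      exact_mod_cast Nat.succ_mul_centralBinom_succ n
    have p1 : (0 : ℝ) < (n.centralBinom : ℝ) := by exact_mod_cast n.centralBinom_pos
    have p2 : (0 : ℝ) < ((n + 1).centralBinom : ℝ) := by exact_mod_cast (n + 1).centralBinom_pos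
    have p3 : (0 : ℝ) < 2 * (n : ℝ) + 1 := by positivity
    have p4 : (0 : ℝ) < (n : ℝ) + 1 := by positivity
    have p5 : (0 : ℝ) < 2 * (n : ℝ) + 3 := by positivity
    have hI : (4 * (n : ℝ) + 6) * ∫ t in (0 : ℝ)..1, (t * (1 - t)) ^ (n + 1) =
        (n + 1) * (1 / ((2 * (n : ℝ) + 1) * (n.centralBinom : ℝ))) := by
      simp at key
      simp
      linarith
    have h6 : ((n : ℝ) + 1) * (1 / ((2 * (n : ℝ) + 1) * (n.centralBinom : ℝ))) =
        2 / ((n + 1).centralBinom : ℝ) := by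
      field_simp
      linarith
    rw [h6] at hI
    rw [eq_div_iff (by positivity)]
    push_cast
    field_simp at hI
    linarith

/-- Cauchy product of the series of `-log(1 - yq)` with the geometric series. -/
theorem hasSum_pow_mul_sum_pow_div {y q : ℝ} (hy : 0 ≤ y) (hq : 0 ≤ q) (hq1 : q < 1)
    (hyq : y * q < 1) :
    HasSum (fun n : ℕ => q ^ n * ∑ p ∈ Finset.Icc 1 n, y ^ p / (p : ℝ))
      (-Real.log (1 - y * q) / (1 - q)) := by
  have hf : HasSum (fun p : ℕ => (y * q) ^ p / (p : ℝ)) (-Real.log (1 - y * q)) := by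
    -- The term `p = 0` is `1 / 0 = 0`, so the index can be shifted freely.
    rw [← hasSum_nat_add_iff' 1]
    simpa using Real.hasSum_pow_div_log_of_abs_lt_one
      (by rwa [abs_of_nonneg (by positivity)] : |y * q| < 1)
  have hg : HasSum (fun n : ℕ => q ^ n) (1 - q)⁻¹ := hasSum_geometric_of_lt_one hq hq1
  have h := hasSum_sum_range_mul_of_summable_norm hf.summable.norm hg.summable.norm
  rw [hf.tsum_eq, hg.tsum_eq, ← div_eq_mul_inv] at h
  convert! h using 2 with n
  rw [Finset.range_eq_Ico, Finset.sum_eq_sum_Ico_succ_bot (by omega), Finset.mul_sum]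
  simp only [Nat.cast_zero, div_zero, zero_mul, zero_add]
  refine Finset.sum_congr rfl fun p hp => ?_
  have hp' : p ≤ n := (Finset.mem_Icc.1 hp).2
  rw [← Nat.add_sub_cancel' hp', pow_add, Nat.add_sub_cancel_left, mul_pow]
  ring

theorem continuousOn_neg_log_div {y : ℝ} (hy : 0 ≤ y) (hy2 : y < 2) {s : Set ℝ} :
    ContinuousOn (fun t : ℝ => -Real.log (1 - y * (2 * t * (1 - t))) / (1 - 2 * t * (1 - t))) s := by
  have h1 : ∀ t : ℝ, 2 * t * (1 - t) ≤ 1 / 2 := fun t => by nlinarith [sq_nonneg (2 * t - 1)]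
  refine ContinuousOn.div (ContinuousOn.neg (ContinuousOn.log (by fun_prop) ?_)) (by fun_prop) ?_
  · intro t _
    nlinarith [h1 t]
  · intro t _
    linarith [h1 t]

theorem hasSum_central_binom_sum {y : ℝ} (hy : 0 ≤ y) (hy2 : y < 2) :
    HasSum (fun n : ℕ => (2 : ℝ) ^ n * (∑ p ∈ Finset.Icc 1 n, y ^ p / (p : ℝ)) /
        ((2 * (n : ℝ) + 1) * ((2 * n).choose n : ℝ)))
      (∫ t in (0 : ℝ)..1, -Real.log (1 - y * (2 * t * (1 - t))) / (1 - 2 * t * (1 - t))) := by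
  have hH : ∀ n : ℕ, 0 ≤ ∑ p ∈ Finset.Icc 1 n, y ^ p / (p : ℝ) := fun n =>
    Finset.sum_nonneg fun p _ => by positivity
  have hq : ∀ t ∈ Set.uIoc (0 : ℝ) 1, 0 ≤ 2 * t * (1 - t) ∧ 2 * t * (1 - t) ≤ 1 / 2 := by
    intro t ht
    rw [Set.uIoc_of_le zero_le_one] at ht
    exact ⟨mul_nonneg (by linarith [ht.1]) (by linarith [ht.2]),
      by nlinarith [sq_nonneg (2 * t - 1)]⟩
  have h := intervalIntegral.hasSum_integral_of_dominated_convergence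
    (μ := MeasureTheory.volume) (a := (0 : ℝ)) (b := 1)
    (F := fun (n : ℕ) (t : ℝ) => (2 * t * (1 - t)) ^ n * ∑ p ∈ Finset.Icc 1 n, y ^ p / (p : ℝ))
    (f := fun t : ℝ => -Real.log (1 - y * (2 * t * (1 - t))) / (1 - 2 * t * (1 - t)))
    -- The dominating series is the same one at `q = 1/2`, the maximum of `2t(1-t)`; it converges
    -- because `y/2 < 1`.
    (fun n _ => (1 / 2 : ℝ) ^ n * ∑ p ∈ Finset.Icc 1 n, y ^ p / (p : ℝ))
    (fun n => (by fun_prop : Continuous _).aestronglyMeasurable)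
    (fun n => Filter.Eventually.of_forall fun t ht => by
      have := hq t ht
      rw [Real.norm_of_nonneg (mul_nonneg (pow_nonneg this.1 n) (hH n))]
      exact mul_le_mul_of_nonneg_right (pow_le_pow_left₀ this.1 this.2 n) (hH n))
    (Filter.Eventually.of_forall fun t _ => (hasSum_pow_mul_sum_pow_div hy (by norm_num)
      (by norm_num) (by linarith)).summable)
    intervalIntegrable_const
    (Filter.Eventually.of_forall fun t ht => by
      have := hq t ht
      exact hasSum_pow_mul_sum_pow_div hy this.1 (by linarith) (by nlinarith))
  convert! h using 2 with n
  have h2 : ∀ t : ℝ, (2 * t * (1 - t)) ^ n * ∑ p ∈ Finset.Icc 1 n, y ^ p / (p : ℝ) =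
      (2 ^ n * ∑ p ∈ Finset.Icc 1 n, y ^ p / (p : ℝ)) * (t * (1 - t)) ^ n := fun t => by
    rw [mul_assoc 2, mul_pow]; ring
  simp_rw [h2]
  rw [intervalIntegral.integral_const_mul, integral_mul_one_sub_pow, Nat.centralBinom]
  ring

/-! ### Logarithmic integrals. -/

theorem intervalIntegrable_log_one_add_div :
    IntervalIntegrable (fun x : ℝ => Real.log (1 + x) / (1 + x ^ 2))
      MeasureTheory.volume 0 1 := by
  refine ContinuousOn.intervalIntegrable ?_
  rw [Set.uIcc_of_le zero_le_one]
  refine ContinuousOn.div (ContinuousOn.log (by fun_prop) ?_) (by fun_prop) ?_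
  · intro x hx
    linarith [hx.1]
  · intro x _
    positivity

/-- The involution `x ↦ (1-x)/(1+x)` preserves `dx/(1+x²)` up to orientation and sends `1+x` to
`2/(1+x)`, so `I = (π/4) log 2 - I`. -/
theorem integral_log_one_add_div :
    ∫ x in (0 : ℝ)..1, Real.log (1 + x) / (1 + x ^ 2) = Real.pi / 8 * Real.log 2 := by
  have hsub := intervalIntegral.integral_comp_mul_deriv' (a := (0 : ℝ)) (b := 1)
    (f := fun x => (1 - x) / (1 + x)) (f' := fun x => -2 / (1 + x) ^ 2)
    (g := fun x : ℝ => Real.log (1 + x) / (1 + x ^ 2))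
    (by
      intro x hx
      rw [Set.uIcc_of_le zero_le_one] at hx
      have hx1 : 1 + x ≠ 0 := by linarith [hx.1]
      refine (((hasDerivAt_id x).const_sub 1).div ((hasDerivAt_id x).const_add 1) hx1).congr_deriv ?_
      simp only [id]
      congr 1
      ring)
    (by
      rw [Set.uIcc_of_le zero_le_one]
      refine ContinuousOn.div (by fun_prop) (by fun_prop) ?_
      intro x hx
      have : 0 < 1 + x := by linarith [hx.1]
      positivity)
    (by
      rw [Set.uIcc_of_le zero_le_one]
      refine ContinuousOn.div (ContinuousOn.log (by fun_prop) ?_) (by fun_prop) ?_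
      · rintro _ ⟨x, hx, rfl⟩
        have h1 : 0 < 1 + x := by linarith [hx.1]
        have : 0 ≤ (1 - x) / (1 + x) := div_nonneg (by linarith [hx.2]) h1.le
        dsimp only
        linarith
      · intro x _
        positivity)
  have hcongr : ∫ x in (0 : ℝ)..1, ((fun x : ℝ => Real.log (1 + x) / (1 + x ^ 2)) ∘
      fun x => (1 - x) / (1 + x)) x * (-2 / (1 + x) ^ 2) =
      ∫ x in (0 : ℝ)..1, (Real.log (1 + x) / (1 + x ^ 2) - Real.log 2 * (1 / (1 + x ^ 2))) := by
    refine intervalIntegral.integral_congr fun x hx => ?_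
    rw [Set.uIcc_of_le zero_le_one] at hx
    have hx1 : 0 < 1 + x := by linarith [hx.1]
    have e1 : 1 + (1 - x) / (1 + x) = 2 / (1 + x) := by field_simp; ring
    have e2 : 1 + ((1 - x) / (1 + x)) ^ 2 = 2 * (1 + x ^ 2) / (1 + x) ^ 2 := by field_simp; ring
    simp only [Function.comp]
    rw [e1, e2, Real.log_div two_ne_zero hx1.ne']
    have : 0 < 1 + x ^ 2 := by positivity
    field_simp
    ring
  have hint2 : IntervalIntegrable (fun x : ℝ => 1 / (1 + x ^ 2)) MeasureTheory.volume 0 1 :=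
    (ContinuousOn.div (by fun_prop) (by fun_prop) fun x _ => by positivity).intervalIntegrable
  rw [hcongr, intervalIntegral.integral_sub intervalIntegrable_log_one_add_div
    (hint2.const_mul _), intervalIntegral.integral_const_mul,
    integral_one_div_one_add_sq] at hsub
  norm_num at hsub
  rw [intervalIntegral.integral_symm 0 1] at hsub
  linarith

/-- The integrand is symmetric under `t ↦ 1 - t`, hence the factor 2; `t = x/(1+x)` then carries
`[0,1]` onto `[0,1/2]`. -/
theorem integral_neg_log_div_eq {y : ℝ} (hy : 0 ≤ y) (hy2 : y < 2) :
    ∫ t in (0 : ℝ)..1, -Real.log (1 - y * (2 * t * (1 - t))) / (1 - 2 * t * (1 - t)) =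
      2 * ∫ x in (0 : ℝ)..1, (2 * (Real.log (1 + x) / (1 + x ^ 2)) -
        Real.log (x ^ 2 - 2 * (y - 1) * x + 1) / (x ^ 2 + 1)) := by
  set g : ℝ → ℝ := fun t =>
    -Real.log (1 - y * (2 * t * (1 - t))) / (1 - 2 * t * (1 - t)) with hg
  have hint : ∀ a b : ℝ, IntervalIntegrable g MeasureTheory.volume a b := fun a b =>
    (continuousOn_neg_log_div hy hy2).intervalIntegrable
  have hsymm : ∫ t in (1 / 2 : ℝ)..1, g t = ∫ t in (0 : ℝ)..(1 / 2), g t := by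
    have h := intervalIntegral.integral_comp_sub_left (a := 0) (b := 1 / 2) g 1
    rw [sub_zero, show (1 : ℝ) - 1 / 2 = 1 / 2 by norm_num] at h
    rw [← h]
    refine intervalIntegral.integral_congr fun t _ => ?_
    simp only [hg]
    ring_nf
  have hsub := intervalIntegral.integral_comp_mul_deriv' (a := (0 : ℝ)) (b := 1)
    (f := fun x => x / (1 + x)) (f' := fun x => 1 / (1 + x) ^ 2) (g := g)
    (by
      intro x hx
      rw [Set.uIcc_of_le zero_le_one] at hx
      have hx1 : 1 + x ≠ 0 := by linarith [hx.1]
      refine ((hasDerivAt_id x).div ((hasDerivAt_id x).const_add 1) hx1).congr_deriv ?_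
      simp only [id]
      congr 1
      ring)
    (by
      rw [Set.uIcc_of_le zero_le_one]
      refine ContinuousOn.div (by fun_prop) (by fun_prop) ?_
      intro x hx
      have : 0 < 1 + x := by linarith [hx.1]
      positivity)
    (continuousOn_neg_log_div hy hy2)
  norm_num at hsub
  rw [← intervalIntegral.integral_add_adjacent_intervals (hint 0 (1 / 2)) (hint (1 / 2) 1), hsymm,
    ← two_mul]
  norm_num
  rw [← hsub]
  refine intervalIntegral.integral_congr fun x hx => ?_
  rw [Set.uIcc_of_le zero_le_one] at hx
  have hx0 := hx.1
  have hx1 : 0 < 1 + x := by linarith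
  have hpos : 0 < x ^ 2 - 2 * (y - 1) * x + 1 := by
    nlinarith [sq_nonneg (1 - x), hx.2, mul_nonneg hx0 (sub_nonneg.2 hy2.le)]
  have e1 : 1 - y * (2 * (x / (1 + x)) * (1 - x / (1 + x))) =
      (x ^ 2 - 2 * (y - 1) * x + 1) / (1 + x) ^ 2 := by field_simp; ring
  have e2 : 1 - 2 * (x / (1 + x)) * (1 - x / (1 + x)) = (1 + x ^ 2) / (1 + x) ^ 2 := by
    field_simp; ring
  simp only [hg]
  rw [e1, e2, Real.log_div hpos.ne' (by positivity), Real.log_pow, add_comm (x ^ 2) 1]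
  have : 0 < 1 + x ^ 2 := by positivity
  field_simp
  push_cast
  ring

theorem intervalIntegrable_log_quadratic_div {c : ℝ} (hc : c < 1) :
    IntervalIntegrable (fun x : ℝ => Real.log (x ^ 2 - 2 * c * x + 1) / (x ^ 2 + 1))
      MeasureTheory.volume 0 1 := by
  refine ContinuousOn.intervalIntegrable ?_
  rw [Set.uIcc_of_le zero_le_one]
  refine ContinuousOn.div (ContinuousOn.log (by fun_prop) ?_) (by fun_prop) ?_
  · intro x hx
    have : 0 < x ^ 2 - 2 * c * x + 1 := by
      rcases hx.1.eq_or_lt with h | h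
      · simp [← h]
      · nlinarith [sq_nonneg (1 - x), mul_pos h (sub_pos.2 hc)]
    exact this.ne'
  · intro x _
    positivity

/-! ### Factorisation and assembly. -/

/-- The complex roots are `exp((2j+1)πi/m)`: `j = r` gives `-1`, and `j = k` is conjugate to `j = 2r
- k`. -/
theorem pow_add_one_eq_prod_cos (r : ℕ) (x : ℝ) :
    x ^ (2 * r + 1) + 1 = (x + 1) * ∏ k ∈ Finset.range r, (x ^ 2 - 2 * phi (2 * r + 1) k * x + 1) := by
  have hm0 : ((2 * r + 1 : ℕ) : ℂ) ≠ 0 := by exact_mod_cast Nat.succ_ne_zero (2 * r)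
  set w : ℂ := Real.pi * Complex.I / ((2 * r + 1 : ℕ) : ℂ) with hw
  have hα : Complex.exp w ^ (2 * r + 1) = -1 := by
    rw [← Complex.exp_nat_mul, hw, mul_div_cancel₀ _ hm0, Complex.exp_pi_mul_I]
  have h := congrArg (Polynomial.eval (x : ℂ)) (X_pow_sub_C_eq_prod
    (Complex.isPrimitiveRoot_exp (2 * r + 1) (Nat.succ_ne_zero _)) (Nat.succ_pos _) hα)
  rw [Polynomial.eval_prod] at h
  simp only [Polynomial.eval_sub, Polynomial.eval_pow, Polynomial.eval_X, Polynomial.eval_C,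
    sub_neg_eq_add] at h
  have hterm : ∀ j : ℕ, Complex.exp (2 * Real.pi * Complex.I / ((2 * r + 1 : ℕ) : ℂ)) ^ j *
      Complex.exp w = Complex.exp ((2 * j + 1) * w) := by
    intro j
    rw [← Complex.exp_nat_mul, ← Complex.exp_add, hw]
    congr 1
    ring
  simp only [hterm] at h
  rw [show 2 * r + 1 = r + 1 + r by ring, Finset.prod_range_add, Finset.prod_range_succ,
    ← Finset.prod_range_reflect (fun j => (x : ℂ) - Complex.exp ((2 * ((r + 1 + j : ℕ) : ℂ) + 1) * w)),
    mul_right_comm, ← Finset.prod_mul_distrib] at h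
  have hmid : (x : ℂ) - Complex.exp ((2 * (r : ℂ) + 1) * w) = x + 1 := by
    have : (2 * (r : ℂ) + 1) * w = Real.pi * Complex.I := by
      rw [hw]; push_cast at hm0 ⊢; field_simp
    rw [this, Complex.exp_pi_mul_I, sub_neg_eq_add]
  have hpair : ∀ k ∈ Finset.range r, ((x : ℂ) - Complex.exp ((2 * (k : ℂ) + 1) * w)) *
      ((x : ℂ) - Complex.exp ((2 * ((r + 1 + (r - 1 - k) : ℕ) : ℂ) + 1) * w)) =
      (x : ℂ) ^ 2 - 2 * (phi (2 * r + 1) k : ℂ) * x + 1 := by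
    intro k hk
    have hk' := Finset.mem_range.1 hk
    have e1 : ((r + 1 + (r - 1 - k) : ℕ) : ℂ) = 2 * r - k := by
      rw [show r + 1 + (r - 1 - k) = 2 * r - k by omega, Nat.cast_sub (by omega)]
      push_cast; ring
    have e2 : (2 * ((2 * r : ℂ) - k) + 1) * w = 2 * Real.pi * Complex.I - (2 * (k : ℂ) + 1) * w := by
      rw [hw]; push_cast at hm0 ⊢; field_simp; ring
    have e3 : Complex.exp ((2 * (k : ℂ) + 1) * w) * Complex.exp (-((2 * (k : ℂ) + 1) * w)) = 1 := by
      rw [← Complex.exp_add, add_neg_cancel, Complex.exp_zero]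
    have e4 : 2 * (phi (2 * r + 1) k : ℂ) =
        Complex.exp ((2 * (k : ℂ) + 1) * w) + Complex.exp (-((2 * (k : ℂ) + 1) * w)) := by
      rw [phi, Complex.ofReal_cos, Complex.two_cos, hw]
      push_cast
      congr 2 <;> ring
    rw [e1, e2, sub_eq_add_neg, sub_eq_add_neg (2 * (Real.pi : ℂ) * Complex.I), Complex.exp_add,
      Complex.exp_two_pi_mul_I, e4]
    linear_combination e3
  rw [hmid, Finset.prod_congr rfl hpair, mul_comm] at h
  rw [show 2 * r + 1 = r + 1 + r by ring] at *
  exact_mod_cast h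

theorem phi_mem_Ico {r k : ℕ} (hk : k < r) :
    -1 ≤ phi (2 * r + 1) k ∧ phi (2 * r + 1) k < 1 := by
  refine ⟨Real.neg_one_le_cos _, ?_⟩
  have hm : (0 : ℝ) < ((2 * r + 1 : ℕ) : ℝ) := by positivity
  have hk' : (k : ℝ) + 1 ≤ r := by exact_mod_cast hk
  have hlt : (2 * (k : ℝ) + 1) * Real.pi / ((2 * r + 1 : ℕ) : ℝ) ≤ Real.pi := by
    rw [div_le_iff₀ hm, mul_comm]
    refine mul_le_mul_of_nonneg_left ?_ Real.pi_pos.le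
    push_cast
    linarith
  have hpos : 0 < (2 * (k : ℝ) + 1) * Real.pi / ((2 * r + 1 : ℕ) : ℝ) := by
    have := Real.pi_pos
    positivity
  simpa [phi] using Real.cos_lt_cos_of_nonneg_of_le_pi le_rfl hlt hpos

theorem integral_log_quadratic_div {c : ℝ} (hc : -1 ≤ c) (hc1 : c < 1) :
    ∫ x in (0 : ℝ)..1, Real.log (x ^ 2 - 2 * c * x + 1) / (x ^ 2 + 1) =
      Real.pi / 4 * Real.log 2 - 1 / 2 *
        ∫ t in (0 : ℝ)..1, -Real.log (1 - (c + 1) * (2 * t * (1 - t))) / (1 - 2 * t * (1 - t)) := by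
  rw [integral_neg_log_div_eq (by linarith) (by linarith), add_sub_cancel_right,
    intervalIntegral.integral_sub (intervalIntegrable_log_one_add_div.const_mul 2)
      (intervalIntegrable_log_quadratic_div hc1),
    intervalIntegral.integral_const_mul, integral_log_one_add_div]
  ring

theorem theorem2p9 (m : ℕ) (hm1 : 1 ≤ m) (hm : Odd m) :
    IntervalIntegrable (fun x : ℝ => Real.log (x ^ m + 1) / (x ^ 2 + 1))
        MeasureTheory.volume 0 1 ∧
      (∀ k ∈ Finset.range ((m - 1) / 2), Summable (fun n : ℕ => innerTerm m k n)) ∧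
      ∫ x in (0 : ℝ)..1, Real.log (x ^ m + 1) / (x ^ 2 + 1) =
        Real.pi * (m : ℝ) / 8 * Real.log 2 -
          1 / 2 * ∑ k ∈ Finset.range ((m - 1) / 2), ∑' n : ℕ, innerTerm m k n := by
  obtain ⟨r, rfl⟩ := hm
  rw [show (2 * r + 1 - 1) / 2 = r by omega]
  have hsum : ∀ k ∈ Finset.range r, HasSum (fun n : ℕ => innerTerm (2 * r + 1) k n)
      (∫ t in (0 : ℝ)..1, -Real.log (1 - (phi (2 * r + 1) k + 1) * (2 * t * (1 - t))) /
        (1 - 2 * t * (1 - t))) := fun k hk => by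
    have := phi_mem_Ico (Finset.mem_range.1 hk)
    exact hasSum_central_binom_sum (by linarith) (by linarith)
  have hint1 : IntervalIntegrable (fun x : ℝ => Real.log (x + 1) / (x ^ 2 + 1))
      MeasureTheory.volume 0 1 := by
    simpa only [add_comm] using intervalIntegrable_log_one_add_div
  have hint2 : ∀ k ∈ Finset.range r, IntervalIntegrable (fun x : ℝ =>
      Real.log (x ^ 2 - 2 * phi (2 * r + 1) k * x + 1) / (x ^ 2 + 1)) MeasureTheory.volume 0 1 :=
    fun k hk => intervalIntegrable_log_quadratic_div (phi_mem_Ico (Finset.mem_range.1 hk)).2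
  have hlog : ∀ x ∈ Set.uIcc (0 : ℝ) 1, Real.log (x ^ (2 * r + 1) + 1) / (x ^ 2 + 1) =
      Real.log (x + 1) / (x ^ 2 + 1) + ∑ k ∈ Finset.range r,
        Real.log (x ^ 2 - 2 * phi (2 * r + 1) k * x + 1) / (x ^ 2 + 1) := by
    intro x hx
    rw [Set.uIcc_of_le zero_le_one] at hx
    have hprod : x ^ (2 * r + 1) + 1 ≠ 0 := by
      have := hx.1
      positivity
    rw [pow_add_one_eq_prod_cos] at hprod ⊢
    rw [Real.log_mul (left_ne_zero_of_mul hprod) (right_ne_zero_of_mul hprod),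
      Real.log_prod (Finset.prod_ne_zero_iff.1 (right_ne_zero_of_mul hprod)), add_div,
      Finset.sum_div]
  refine ⟨?_, fun k hk => (hsum k hk).summable, ?_⟩
  · refine ContinuousOn.intervalIntegrable ?_
    rw [Set.uIcc_of_le zero_le_one]
    refine ContinuousOn.div (ContinuousOn.log (by fun_prop) ?_) (by fun_prop) ?_
    · intro x hx
      have := hx.1
      positivity
    · intro x _
      positivity
  · have h1 : ∫ x in (0 : ℝ)..1, Real.log (x + 1) / (x ^ 2 + 1) = Real.pi / 8 * Real.log 2 := by
      rw [← integral_log_one_add_div]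
      simp only [add_comm]
    have hint3 := IntervalIntegrable.sum (Finset.range r) hint2
    simp only [Finset.sum_fn] at hint3
    rw [intervalIntegral.integral_congr hlog, intervalIntegral.integral_add hint1 hint3,
      intervalIntegral.integral_finsetSum hint2, h1,
      Finset.sum_congr rfl fun k hk => integral_log_quadratic_div
        (phi_mem_Ico (Finset.mem_range.1 hk)).1 (phi_mem_Ico (Finset.mem_range.1 hk)).2,
      Finset.sum_congr rfl fun k hk => (hsum k hk).tsum_eq, Finset.sum_sub_distrib,
      Finset.sum_const, Finset.card_range, nsmul_eq_mul, ← Finset.mul_sum]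
    push_cast
    ring
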